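/- All groups are Polish (their topology is separable and completely metrizable). A Polish group $G$ is called quasi-torsion if it is topologically isomorphic to a closed subgroup of a product $\prod_{n\in\mathbb{N}} G_n$ (with the product topology) of countable discrete torsion groups $G_n$ such that every coordinate projection $G \to G_n$ is surjective. For a prime $p$, the $p$-Sylow subgroup of an abelian quasi-torsion group $G$ is the group of all $g \in G$ such that the closed subgroup $\overline{\langle g\rangle}$ is a pro-$p$ group (a profinite group all of whose quotients by open normal subgroups are finite $p$-groups). Let $G$ be an abelian quasi-torsion group. Suppose that $G$ is not locally compact and that, for every prime $p$, the $p$-Sylow subgroup of $G$ is locally compact. Then there exist a closed subgroup $L \leq G$ and infinite (countable) discrete groups $K_n$, $n \in \mathbb{N}$, such that the product $\prod_{n\in\mathbb{N}} K_n$, with the product topology, is topologically isomorphic to a closed subgroup of $G/L$ with the quotient topology. -/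

import Mathlib

open Topology

/-- `IsQuasi D G`: the topological group `G` is (topologically isomorphic to) a closed subdirect
product of countably many countable discrete groups belonging to the class `D`, i.e. a closed
subgroup of a product `∏ₙ Aₙ` all of whose coordinate projections are surjective.
(Every countable group has an isomorphic copy in `Type`, so nothing is lost by taking `Aₙ` there.) -/
def IsQuasi (D : (A : Type) → [Group A] → Prop) (G : Type*) [Group G] [TopologicalSpace G] :
    Prop :=
  ∃ (A : ℕ → Type) (_ : ∀ n, Group (A n)) (_ : ∀ n, TopologicalSpace (A n))
    (φ : G →* ∀ n, A n),
    (∀ n, Countable (A n) ∧ DiscreteTopology (A n) ∧ D (A n)) ∧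
    IsClosedEmbedding φ ∧ ∀ n, Function.Surjective fun g => φ g n

/-- Quasi-torsion groups: closed subdirect products of countable discrete torsion groups. -/
def IsQuasiTorsion (G : Type*) [Group G] [TopologicalSpace G] : Prop :=
  IsQuasi (fun A _ => IsMulTorsion A) G

/-- Pro-`p` groups: profinite groups all of whose quotients by open normal subgroups
are (necessarily finite) `p`-groups. -/
def IsProP (p : ℕ) (H : Type*) [Group H] [TopologicalSpace H] [IsTopologicalGroup H] : Prop :=
  CompactSpace H ∧ T2Space H ∧ TotallyDisconnectedSpace H ∧
    ∀ (N : Subgroup H) [N.Normal], IsOpen (N : Set H) → IsPGroup p (H ⧸ N)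

/-- `g` is a pro-`p` element if the closed subgroup topologically generated by `g` is pro-`p`. -/
def IsProPElement {G : Type*} [Group G] [TopologicalSpace G] [IsTopologicalGroup G]
    (p : ℕ) (g : G) : Prop :=
  IsProP p (Subgroup.zpowers g).topologicalClosure

/-- The (underlying set of the) `p`-Sylow subgroup of an abelian group of the above kind:
the set of all pro-`p` elements. -/
def proPSylow (p : ℕ) (G : Type*) [CommGroup G] [TopologicalSpace G] [IsTopologicalGroup G] :
    Set G :=
  {g | IsProPElement p g}

/-! Embed `G` in a product of discrete torsion abelian groups. A set `P` of primes is large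
(`IsLargeAt`) if no neighbourhood of 1 has a compact `P`-primary part; compactness means finite
images in all finite partial products. Since `G` is not locally compact, the set of all primes is
large; since the Sylow subgroups are locally compact, no single prime is. When a large set is cut in
two, one piece stays large, so part of it can be removed that still has an infinite image while the
rest remains large (`IsLargeAt.exists_subset`). Iterating gives disjoint sets `Q k` and infinite
images `tailImage` of the `Q k`-parts of ever smaller neighbourhoods. Take `L` to be the kernel of
the map reading off these primary coordinates: products of elements chosen in shrinking tails
converge, and disjointness lets each factor be recovered, so the product of the images embeds in `G
⧸ L`. -/

/-! ### Primary decomposition of torsion abelian groups -/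

/-- The subgroup of elements all of whose order's prime divisors lie in `P`. -/
def primePart (P : Set ℕ) (A : Type*) [CommGroup A] : Subgroup A where
  carrier := {a | IsOfFinOrder a ∧ ∀ q : ℕ, q.Prime → q ∣ orderOf a → q ∈ P}
  one_mem' := ⟨IsOfFinOrder.one, fun q hq h => by
    rw [orderOf_one] at h; exact absurd (Nat.dvd_one.1 h) hq.ne_one⟩
  mul_mem' := by
    rintro a b ⟨ha, ha'⟩ ⟨hb, hb'⟩
    refine ⟨(Commute.all a b).isOfFinOrder_mul ha hb, fun q hq h => ?_⟩
    have h1 := h.trans ((Commute.all a b).orderOf_mul_dvd_mul_orderOf)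
    exact (hq.dvd_mul.1 h1).elim (ha' q hq) (hb' q hq)
  inv_mem' := by
    rintro a ⟨ha, ha'⟩
    exact ⟨ha.inv, fun q hq h => ha' q hq (by rwa [orderOf_inv] at h)⟩

section PrimePart

variable {A B : Type*} [CommGroup A] [CommGroup B] {P Q : Set ℕ}

lemma map_mem_primePart (f : A →* B) {a : A} (ha : a ∈ primePart P A) :
    f a ∈ primePart P B :=
  ⟨f.isOfFinOrder ha.1, fun q hq h => ha.2 q hq (h.trans (orderOf_map_dvd f a))⟩

lemma primePart_mono (h : P ⊆ Q) : primePart P A ≤ primePart Q A :=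
  fun _ ha => ⟨ha.1, fun q hq hd => h (ha.2 q hq hd)⟩

lemma mem_primePart_inter {a : A} (h : a ∈ primePart P A) (h' : a ∈ primePart Q A) :
    a ∈ primePart (P ∩ Q) A :=
  ⟨h.1, fun q hq hd => ⟨h.2 q hq hd, h'.2 q hq hd⟩⟩

lemma eq_one_of_mem_primePart_of_disjoint (hPQ : Disjoint P Q) {a : A}
    (h : a ∈ primePart P A) (h' : a ∈ primePart Q A) : a = 1 := by
  rw [← orderOf_eq_one_iff]
  by_contra hne
  obtain ⟨q, hq, hd⟩ := Nat.exists_prime_and_dvd hne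
  exact Set.disjoint_left.1 hPQ (h.2 q hq hd) (h'.2 q hq hd)

lemma mem_primePart_of_pow_eq_one {a : A} {u : ℕ} (hu : u ≠ 0) (h : a ^ u = 1)
    (hP : ∀ q : ℕ, q.Prime → q ∣ u → q ∈ P) : a ∈ primePart P A :=
  ⟨isOfFinOrder_iff_pow_eq_one.2 ⟨u, Nat.pos_of_ne_zero hu, h⟩,
    fun q hq hd => hP q hq (hd.trans (orderOf_dvd_of_pow_eq_one h))⟩

lemma exists_eq_mul_of_prime_dvd (P : Set ℕ) (N : ℕ) (hN : N ≠ 0) : ∃ u v : ℕ, N = u * v ∧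
    (∀ q : ℕ, q.Prime → q ∣ u → q ∈ P) ∧ (∀ q : ℕ, q.Prime → q ∣ v → q ∈ Pᶜ) := by
  induction N using induction_on_primes with
  | zero => exact absurd rfl hN
  | one => exact ⟨1, 1, rfl, fun q hq h => absurd (Nat.dvd_one.1 h) hq.ne_one,
      fun q hq h => absurd (Nat.dvd_one.1 h) hq.ne_one⟩
  | prime_mul p a hp ih =>
    obtain ⟨u, v, rfl, hu, hv⟩ := ih (right_ne_zero_of_mul hN)
    by_cases hpP : p ∈ P
    · refine ⟨p * u, v, by ring, fun q hq h => ?_, hv⟩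
      rcases hq.dvd_mul.1 h with h | h
      · rwa [(Nat.prime_dvd_prime_iff_eq hq hp).1 h]
      · exact hu q hq h
    · refine ⟨u, p * v, by ring, hu, fun q hq h => ?_⟩
      rcases hq.dvd_mul.1 h with h | h
      · rwa [(Nat.prime_dvd_prime_iff_eq hq hp).1 h]
      · exact hv q hq h

lemma exists_pow_mem_primePart (P : Set ℕ) {a : A} (ha : IsOfFinOrder a) :
    ∃ e : ℕ, a ^ e ∈ primePart P A ∧ a * (a ^ e)⁻¹ ∈ primePart Pᶜ A := by
  have hN : orderOf a ≠ 0 := ha.orderOf_pos.ne'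
  obtain ⟨u, v, huv, hu, hv⟩ := exists_eq_mul_of_prime_dvd P (orderOf a) hN
  have hu0 : u ≠ 0 := fun h => hN (by simp [huv, h])
  have hv0 : v ≠ 0 := fun h => hN (by simp [huv, h])
  have hco : u.Coprime v := Nat.Coprime.symm <| Nat.coprime_of_dvd fun q hq h h' =>
    hv q hq h (hu q hq h')
  -- With `e ≡ 1` mod `u` and `e ≡ 0` mod `v`, `u` kills `a ^ e` and `v` kills the complementary
  -- factor.
  obtain ⟨e, he1, he0⟩ := Nat.chineseRemainder hco 1 0
  refine ⟨e, mem_primePart_of_pow_eq_one hu0 ?_ hu, mem_primePart_of_pow_eq_one hv0 ?_ hv⟩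
  · rw [← pow_mul, ← orderOf_dvd_iff_pow_eq_one, huv, mul_comm e u]
    exact Nat.mul_dvd_mul_left u ((Nat.modEq_zero_iff_dvd).1 he0)
  · rw [mul_pow, inv_pow, ← pow_mul, mul_inv_eq_one, pow_eq_pow_iff_modEq, huv]
    simpa using (he1.symm.mul_right' v)

lemma mul_inv_mem_primePart_unique {a y z : A} (hy : y ∈ primePart P A)
    (hy' : a * y⁻¹ ∈ primePart Pᶜ A) (hz : z ∈ primePart P A)
    (hz' : a * z⁻¹ ∈ primePart Pᶜ A) : y = z := by
  rw [← div_eq_one]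
  refine eq_one_of_mem_primePart_of_disjoint (disjoint_compl_right (a := P)) (div_mem hy hz) ?_
  have : y / z = (a * z⁻¹) / (a * y⁻¹) := by
    rw [mul_div_mul_left_eq_div, inv_div_inv]
  rw [this]
  exact div_mem hz' hy'

/-- The projection of a torsion abelian group onto its `P`-primary part. -/
noncomputable def primeProj (P : Set ℕ) (hA : IsMulTorsion A) : A →* A where
  toFun a := a ^ (exists_pow_mem_primePart P (hA a)).choose
  map_one' := one_pow _
  map_mul' a b := by
    have h := (exists_pow_mem_primePart P (hA (a * b))).choose_spec
    have ha := (exists_pow_mem_primePart P (hA a)).choose_spec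
    have hb := (exists_pow_mem_primePart P (hA b)).choose_spec
    refine mul_inv_mem_primePart_unique h.1 h.2 (mul_mem ha.1 hb.1) ?_
    rw [mul_inv, mul_mul_mul_comm]
    exact mul_mem ha.2 hb.2

variable (hA : IsMulTorsion A)

lemma primeProj_mem (a : A) : primeProj P hA a ∈ primePart P A :=
  (exists_pow_mem_primePart P (hA a)).choose_spec.1

lemma mul_inv_primeProj_mem (a : A) : a * (primeProj P hA a)⁻¹ ∈ primePart Pᶜ A :=
  (exists_pow_mem_primePart P (hA a)).choose_spec.2

lemma primeProj_mem_subgroup (H : Subgroup A) {a : A} (ha : a ∈ H) : primeProj P hA a ∈ H :=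
  pow_mem ha _

lemma primeProj_eq {a y : A} (hy : y ∈ primePart P A) (hy' : a * y⁻¹ ∈ primePart Pᶜ A) :
    primeProj P hA a = y :=
  mul_inv_mem_primePart_unique (primeProj_mem hA a) (mul_inv_primeProj_mem hA a) hy hy'

lemma primeProj_of_mem {a : A} (ha : a ∈ primePart P A) : primeProj P hA a = a :=
  primeProj_eq hA ha (by rw [mul_inv_cancel]; exact one_mem _)

lemma primeProj_of_mem_of_disjoint (hPQ : Disjoint P Q) {a : A} (ha : a ∈ primePart Q A) :
    primeProj P hA a = 1 :=
  primeProj_eq hA (one_mem _) (by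
    rw [inv_one, mul_one]; exact primePart_mono hPQ.subset_compl_left ha)

lemma IsMulTorsion.pi {ι : Type*} [Finite ι] {A : ι → Type*} [∀ i, CommGroup (A i)]
    (hA : ∀ i, IsMulTorsion (A i)) : IsMulTorsion (∀ i, A i) := by
  have := Fintype.ofFinite ι
  intro b
  refine isOfFinOrder_iff_pow_eq_one.2 ⟨∏ i, orderOf (b i),
    Finset.prod_pos fun i _ => (hA i (b i)).orderOf_pos, funext fun i => ?_⟩
  exact orderOf_dvd_iff_pow_eq_one.1 (Finset.dvd_prod_of_mem _ (Finset.mem_univ i))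

lemma mem_primePart_pi {ι : Type*} [Finite ι] {A : ι → Type*} [∀ i, CommGroup (A i)]
    (hA : ∀ i, IsMulTorsion (A i)) {b : ∀ i, A i} (hb : ∀ i, b i ∈ primePart P (A i)) :
    b ∈ primePart P (∀ i, A i) := by
  obtain ⟨e, he, he'⟩ := exists_pow_mem_primePart P (IsMulTorsion.pi hA b)
  have : b = b ^ e := by
    rw [← mul_inv_eq_one]
    funext i
    exact eq_one_of_mem_primePart_of_disjoint (disjoint_compl_right (a := P))
      (mul_mem (hb i) (inv_mem (pow_mem (hb i) e)))
      (map_mem_primePart (Pi.evalMonoidHom A i) he')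
  rw [this]
  exact he

end PrimePart

lemma exists_subset_infinite_diff {S : Set ℕ} (hS : S.Infinite) :
    ∃ T ⊆ S, T.Infinite ∧ (S \ T).Infinite := by
  obtain ⟨t, u, rfl, hd, hc⟩ := hS.exists_union_disjoint_cardinal_eq_of_infinite
  have htu : t.Finite ↔ u.Finite := by
    rw [← Cardinal.lt_aleph0_iff_set_finite, hc, Cardinal.lt_aleph0_iff_set_finite]
  have ht : t.Infinite := fun h => hS (h.union (htu.1 h))
  refine ⟨t, Set.subset_union_left, ht, ?_⟩
  rw [Set.union_sdiff_left, hd.symm.sdiff_eq_left]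
  exact fun h => ht (htu.2 h)

/-! ### Primary tails and large sets of primes -/

section piece

variable {G : Type*} [CommGroup G] {A : ℕ → Type*} [∀ n, CommGroup (A n)]
  (φ : G →* ∀ n, A n) {P Q : Set ℕ}

/-- The first `m` coordinates of a homomorphism to a sequential product. -/
def restrictFirst (m : ℕ) : G →* ∀ i : Fin m, A i where
  toFun g i := φ g i
  map_one' := by ext; simp
  map_mul' _ _ := by ext; simp

@[simp] lemma restrictFirst_apply (m : ℕ) (g : G) (i : Fin m) :
    restrictFirst φ m g i = φ g i := rfl

/-- Elements with `P`-primary coordinates of which the first `n` are trivial. -/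
def primaryTail (n : ℕ) (P : Set ℕ) : Subgroup G where
  carrier := {g | (∀ i < n, φ g i = 1) ∧ ∀ i, φ g i ∈ primePart P (A i)}
  one_mem' := ⟨fun i _ => by simp, fun i => by simp [one_mem]⟩
  mul_mem' := fun {a b} ha hb => ⟨fun i hi => by simp [ha.1 i hi, hb.1 i hi],
    fun i => by simpa using mul_mem (ha.2 i) (hb.2 i)⟩
  inv_mem' := fun {a} ha => ⟨fun i hi => by simp [ha.1 i hi],
    fun i => by simpa using ha.2 i⟩

/-- The `P`-primary part of every neighbourhood of the identity has an infinite image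
in some finite product of the coordinates. -/
def IsLargeAt (P : Set ℕ) : Prop :=
  ∀ n, ∃ m, (restrictFirst φ m '' primaryTail φ n P).Infinite

variable {φ}

lemma mem_primaryTail {n : ℕ} {g : G} : g ∈ primaryTail φ n P ↔
    (∀ i < n, φ g i = 1) ∧ ∀ i, φ g i ∈ primePart P (A i) := Iff.rfl

lemma primaryTail_mono {n : ℕ} (h : P ⊆ Q) : primaryTail φ n P ≤ primaryTail φ n Q :=
  fun _ hg => ⟨hg.1, fun i => primePart_mono h (hg.2 i)⟩

lemma primaryTail_anti {n m : ℕ} (h : n ≤ m) : primaryTail φ m P ≤ primaryTail φ n P :=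
  fun _ hg => ⟨fun i hi => hg.1 i (hi.trans_le h), hg.2⟩

/-- Nontrivial elements that are primary for different primes are distinct. -/
lemma infinite_image_restrictFirst_of_infinite {S : Set ℕ} (hS : S.Infinite) {n m : ℕ}
    (h : ∀ p ∈ S, ∃ k ∈ primaryTail φ n {p}, restrictFirst φ m k ≠ 1) :
    (restrictFirst φ m '' primaryTail φ n S).Infinite := by
  choose! k hk hk1 using h
  refine Set.infinite_of_injOn_mapsTo (f := fun p => restrictFirst φ m (k p)) ?_
    (fun p hp => ⟨k p, primaryTail_mono (Set.singleton_subset_iff.2 hp) (hk p hp), rfl⟩) hS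
  intro p hp q hq hpq
  by_contra hne
  refine hk1 p hp (funext fun i => eq_one_of_mem_primePart_of_disjoint
    (Set.disjoint_singleton.2 hne) ((hk p hp).2 i) ?_)
  rw [show restrictFirst φ m (k p) i = φ (k q) i from congrFun hpq i]
  exact (hk q hq).2 i

section topology

variable [TopologicalSpace G] [∀ n, TopologicalSpace (A n)]

lemma exists_map_eq_of_locally (hφ : IsClosedEmbedding φ) (x : ∀ n, A n)
    (h : ∀ n, ∃ g, ∀ i < n, φ g i = x i) : ∃ g, φ g = x := by
  choose g hg using h
  have ht : Filter.Tendsto (fun n => φ (g n)) Filter.atTop (𝓝 x) := by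
    refine tendsto_pi_nhds.2 fun i => ?_
    refine tendsto_const_nhds.congr' ?_
    filter_upwards [Filter.eventually_gt_atTop i] with n hn
    exact (hg n i hn).symm
  exact hφ.isClosed_range.mem_of_tendsto ht (Filter.Eventually.of_forall fun n => ⟨g n, rfl⟩)

lemma exists_forall_mem_of_mem_nhds_one (hφ : IsInducing φ) {V : Set G} (hV : V ∈ 𝓝 (1 : G)) :
    ∃ n, ∀ g, (∀ i < n, φ g i = 1) → g ∈ V := by
  rw [hφ.nhds_eq_comap, map_one, nhds_pi] at hV
  obtain ⟨W, hW, hWV⟩ := hV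
  obtain ⟨I, t, ht, hI⟩ := Filter.mem_pi'.1 hW
  refine ⟨I.sup id + 1, fun g hg => hWV (hI fun i hi => ?_)⟩
  rw [hg i (Nat.lt_succ_of_le (Finset.le_sup (f := id) hi))]
  exact mem_of_mem_nhds (ht i)

lemma isOpen_setOf_forall_lt_eq_one [∀ n, DiscreteTopology (A n)]
    (hφ : Continuous φ) (n : ℕ) :
    IsOpen {g : G | ∀ i < n, φ g i = 1} := by
  have : {g : G | ∀ i < n, φ g i = 1} = ⋂ i ∈ Finset.range n, (fun g => φ g i) ⁻¹' {1} := by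
    ext; simp
  rw [this]
  exact isOpen_biInter_finset fun i _ =>
    (isOpen_discrete _).preimage ((continuous_apply i).comp hφ)

lemma isClosed_primaryTail [∀ n, DiscreteTopology (A n)]
    (hφ : Continuous φ) (n : ℕ) (P : Set ℕ) :
    IsClosed (primaryTail φ n P : Set G) := by
  have : (primaryTail φ n P : Set G) = (⋂ i, ⋂ (_ : i < n), (fun g => φ g i) ⁻¹' {1}) ∩
      ⋂ i, (fun g => φ g i) ⁻¹' (primePart P (A i) : Set (A i)) := by
    ext; simp [mem_primaryTail]
  rw [this]
  have hc : ∀ i, Continuous fun g => φ g i := fun i => (continuous_apply i).comp hφ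
  exact (isClosed_iInter fun i => isClosed_iInter fun _ =>
    (isClosed_discrete _).preimage (hc i)).inter
      (isClosed_iInter fun i => (isClosed_discrete _).preimage (hc i))

lemma finite_image_restrictFirst_of_isCompact [∀ n, DiscreteTopology (A n)]
    (hφ : Continuous φ) {S : Set G} (hS : IsCompact S)
    (m : ℕ) : (restrictFirst φ m '' S).Finite := by
  have hc : Continuous (restrictFirst φ m) :=
    continuous_pi fun i : Fin m => (continuous_apply (i : ℕ)).comp hφ
  exact (hS.image hc).finite_of_discrete

lemma isCompact_of_finite_image_restrictFirst (hφ : IsClosedEmbedding φ) {S : Set G}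
    (hS : IsClosed S) (h : ∀ m, (restrictFirst φ m '' S).Finite) : IsCompact S := by
  have hf : ∀ i, ((fun g => φ g i) '' S).Finite := fun i => by
    refine ((h (i + 1)).image fun x => x (Fin.last i)).subset ?_
    rintro _ ⟨g, hg, rfl⟩
    exact ⟨_, ⟨g, hg, rfl⟩, rfl⟩
  have hK : IsCompact (Set.univ.pi fun i => (fun g => φ g i) '' S) :=
    isCompact_univ_pi fun i => (hf i).isCompact
  exact (hφ.isCompact_preimage hK).of_isClosed_subset hS fun g hg i _ => ⟨g, hg, rfl⟩

variable (hφ : IsClosedEmbedding φ) (hA : ∀ n, IsMulTorsion (A n))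
include hφ hA

/-- On finitely many coordinates the projection is a single power map, so it stays in the image of
`G`; closedness of the image passes to the limit. -/
lemma exists_map_eq_primeProj (P : Set ℕ) (g : G) :
    ∃ h, ∀ i, φ h i = primeProj P (hA i) (φ g i) := by
  obtain ⟨h, hh⟩ := exists_map_eq_of_locally hφ (fun i => primeProj P (hA i) (φ g i))
    fun n => by
      obtain ⟨e, he, he'⟩ := exists_pow_mem_primePart P
        (IsMulTorsion.pi (fun i : Fin n => hA i) (restrictFirst φ n g))
      refine ⟨g ^ e, fun i hi => ?_⟩
      rw [primeProj_eq (hA i) (y := φ g i ^ e)]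
      · simp
      · exact map_mem_primePart (Pi.evalMonoidHom (fun j : Fin n => A j) ⟨i, hi⟩) he
      · exact map_mem_primePart (Pi.evalMonoidHom (fun j : Fin n => A j) ⟨i, hi⟩) he'
  exact ⟨h, fun i => congrFun hh i⟩

lemma exists_mul_eq_of_mem_primaryTail (Q : Set ℕ) {n : ℕ} {g : G}
    (hg : g ∈ primaryTail φ n P) :
    ∃ h ∈ primaryTail φ n (P ∩ Q), ∃ k ∈ primaryTail φ n (P \ Q), h * k = g := by
  obtain ⟨h, hh⟩ := exists_map_eq_primeProj hφ hA Q g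
  have hP : ∀ i, φ h i ∈ primePart P (A i) := fun i => by
    rw [hh]; exact primeProj_mem_subgroup _ _ (hg.2 i)
  have h1 : ∀ i < n, φ h i = 1 := fun i hi => by rw [hh, hg.1 i hi, map_one]
  refine ⟨h, ⟨h1, fun i => mem_primePart_inter (hP i) ?_⟩, g * h⁻¹, ⟨fun i hi => ?_, fun i => ?_⟩,
    by rw [mul_comm, inv_mul_cancel_right]⟩
  · rw [hh]; exact primeProj_mem _ _
  · simp [h1 i hi, hg.1 i hi]
  · rw [map_mul, map_inv, Pi.mul_apply, Pi.inv_apply]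
    refine mem_primePart_inter (mul_mem (hg.2 i) (inv_mem (hP i))) ?_
    rw [hh]
    exact mul_inv_primeProj_mem (P := Q) (hA i) (φ g i)

lemma finite_image_restrictFirst_of_inter_diff (Q : Set ℕ) {n m : ℕ}
    (h : (restrictFirst φ m '' primaryTail φ n (P ∩ Q)).Finite)
    (h' : (restrictFirst φ m '' primaryTail φ n (P \ Q)).Finite) :
    (restrictFirst φ m '' primaryTail φ n P).Finite := by
  refine (Set.Finite.mul h h').subset ?_
  rintro _ ⟨g, hg, rfl⟩
  obtain ⟨a, ha, b, hb, rfl⟩ := exists_mul_eq_of_mem_primaryTail hφ hA Q hg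
  rw [map_mul]
  exact Set.mul_mem_mul ⟨a, ha, rfl⟩ ⟨b, hb, rfl⟩

lemma IsLargeAt.inter_or_diff (hP : IsLargeAt φ P) (Q : Set ℕ) :
    IsLargeAt φ (P ∩ Q) ∨ IsLargeAt φ (P \ Q) := by
  by_contra! hc
  simp only [IsLargeAt, not_forall, not_exists, Set.not_infinite] at hc
  obtain ⟨⟨a, ha⟩, b, hb⟩ := hc
  obtain ⟨m, hm⟩ := hP (max a b)
  exact hm (finite_image_restrictFirst_of_inter_diff hφ hA Q
    ((ha m).subset (Set.image_mono (primaryTail_anti (le_max_left a b))))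
    ((hb m).subset (Set.image_mono (primaryTail_anti (le_max_right a b)))))

lemma finite_image_restrictFirst_of_finite {S : Set ℕ} (hS : S.Finite) {n m : ℕ}
    (h : ∀ p ∈ S, (restrictFirst φ m '' primaryTail φ n {p}).Finite) :
    (restrictFirst φ m '' primaryTail φ n S).Finite := by
  induction S, hS using Set.Finite.induction_on with
  | empty =>
    refine (Set.finite_singleton 1).subset ?_
    rintro _ ⟨g, hg, rfl⟩
    funext i
    exact eq_one_of_mem_primePart_of_disjoint (Set.disjoint_empty ∅) (hg.2 i) (hg.2 i)
  | @insert a s _ _ ih =>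
    refine finite_image_restrictFirst_of_inter_diff hφ hA {a}
      ((h a (Set.mem_insert _ _)).subset (Set.image_mono (primaryTail_mono Set.inter_subset_right)))
      ((ih fun p hp => h p (Set.mem_insert_of_mem _ hp)).subset
        (Set.image_mono (primaryTail_mono ?_)))
    rintro x ⟨hx, hxa⟩
    exact hx.resolve_left hxa

lemma restrictFirst_eq_one_of_forall_prime {n m : ℕ} {g : G} (hg : g ∈ primaryTail φ n P)
    (h : ∀ p ∈ P, p.Prime → ∀ k ∈ primaryTail φ n {p}, restrictFirst φ m k = 1) :
    restrictFirst φ m g = 1 := by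
  by_contra hne
  obtain ⟨q, hq, hd⟩ := Nat.exists_prime_and_dvd (mt orderOf_eq_one_iff.1 hne)
  have hmem : ∀ {R : Set ℕ} {k : G}, k ∈ primaryTail φ n R →
      restrictFirst φ m k ∈ primePart R (∀ i : Fin m, A i) := fun hk =>
    mem_primePart_pi (fun i : Fin m => hA i) fun i : Fin m => hk.2 i
  have hqP : q ∈ P := (hmem hg).2 q hq hd
  obtain ⟨a, ha, b, hb, rfl⟩ := exists_mul_eq_of_mem_primaryTail hφ hA {q} hg
  rw [map_mul, h q hqP hq a (primaryTail_mono Set.inter_subset_right ha), one_mul] at hd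
  exact ((hmem hb).2 q hq hd).2 rfl

lemma IsLargeAt.exists_subset (hP : IsLargeAt φ P)
    (hp : ∀ p : ℕ, p.Prime → ¬ IsLargeAt φ {p}) (n : ℕ) :
    ∃ Q ⊆ P, IsLargeAt φ (P \ Q) ∧ ∃ m, (restrictFirst φ m '' primaryTail φ n Q).Infinite := by
  obtain ⟨m, hm⟩ := hP n
  by_cases hex : ∃ p ∈ P, p.Prime ∧ (restrictFirst φ m '' primaryTail φ n {p}).Infinite
  · obtain ⟨p, hpP, hpp, hinf⟩ := hex
    have hsub : {p} ⊆ P := Set.singleton_subset_iff.2 hpP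
    refine ⟨{p}, hsub, ?_, m, hinf⟩
    refine (hP.inter_or_diff hφ hA {p}).resolve_left ?_
    rw [Set.inter_eq_right.2 hsub]
    exact hp p hpp
  push Not at hex
  set S : Set ℕ := {p | p ∈ P ∧ p.Prime ∧ ∃ k ∈ primaryTail φ n {p}, restrictFirst φ m k ≠ 1}
  have hSP : S ⊆ P := fun p hp => hp.1
  have hS : S.Infinite := by
    intro hfin
    -- Primes of `P` outside `S` contribute nothing to the image, so a finite `S` would make it
    -- finite.
    refine hm (finite_image_restrictFirst_of_inter_diff hφ hA S ?_ ?_)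
    · rw [Set.inter_eq_right.2 hSP]
      exact finite_image_restrictFirst_of_finite hφ hA hfin
        fun p hp => hex p hp.1 hp.2.1
    · refine (Set.finite_singleton 1).subset ?_
      rintro _ ⟨g, hg, rfl⟩
      refine restrictFirst_eq_one_of_forall_prime hφ hA hg fun p hp hpp k hk => ?_
      by_contra hne
      exact hp.2 ⟨hp.1, hpp, k, hk, hne⟩
  -- Whichever of `P ∩ T` and `P \ T` stays large, the other contains an infinite part of `S` and
  -- can be removed.
  obtain ⟨T, hTS, hT, hT'⟩ := exists_subset_infinite_diff hS
  have hinf : ∀ {R}, R ⊆ S → R.Infinite → (restrictFirst φ m '' primaryTail φ n R).Infinite :=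
    fun hRS hR => infinite_image_restrictFirst_of_infinite hR fun p hp => (hRS hp).2.2
  have hTP := hTS.trans hSP
  rcases hP.inter_or_diff hφ hA T with h | h
  · refine ⟨P \ T, Set.sdiff_subset, ?_, m, ?_⟩
    · rwa [Set.sdiff_sdiff_right_self]
    · exact (hinf Set.sdiff_subset hT').mono
        (Set.image_mono (primaryTail_mono (Set.sdiff_subset_sdiff_left hSP)))
  · exact ⟨T, hTP, h, m, hinf hTS hT⟩

end topology

end piece

/-! ### Local compactness and pro-`p` elements -/

section proP

variable {G : Type*} [CommGroup G] [TopologicalSpace G] [IsTopologicalGroup G]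
  {A : ℕ → Type*} [∀ n, CommGroup (A n)] [∀ n, TopologicalSpace (A n)]
  [∀ n, DiscreteTopology (A n)] {φ : G →* ∀ n, A n} (hφ : IsClosedEmbedding φ)
include hφ

lemma locallyCompactSpace_of_not_isLargeAt_univ (hA : ∀ n, IsMulTorsion (A n))
    (h : ¬ IsLargeAt φ Set.univ) : LocallyCompactSpace G := by
  simp only [IsLargeAt, not_forall, not_exists, Set.not_infinite] at h
  obtain ⟨n, hn⟩ := h
  have hK := isCompact_of_finite_image_restrictFirst hφ
    (isClosed_primaryTail hφ.continuous n Set.univ) hn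
  refine hK.locallyCompactSpace_of_mem_nhds_of_group (x := 1) ?_
  refine Filter.mem_of_superset ((isOpen_setOf_forall_lt_eq_one hφ.continuous n).mem_nhds ?_)
    fun g hg => ⟨hg, fun i => ⟨hA i _, fun _ _ _ => Set.mem_univ _⟩⟩
  simp

lemma isProPElement_of_mem_primaryTail {p : ℕ} {g : G} (hg : g ∈ primaryTail φ 0 {p})
    (hA : ∀ n, IsMulTorsion (A n)) : IsProPElement p g := by
  have hle : ∀ m, (Subgroup.zpowers g).topologicalClosure ≤
      (Subgroup.zpowers (restrictFirst φ m g)).comap (restrictFirst φ m) := fun m => by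
    refine Subgroup.topologicalClosure_minimal _ ?_ ?_
    · rw [Subgroup.zpowers_le]
      exact Subgroup.mem_zpowers _
    · have hc : Continuous (restrictFirst φ m) :=
        continuous_pi fun i : Fin m => (continuous_apply (i : ℕ)).comp hφ.continuous
      exact (isClosed_discrete (Subgroup.zpowers (restrictFirst φ m g) : Set _)).preimage hc
  have hpart : ∀ m, restrictFirst φ m g ∈ primePart {p} (∀ i : Fin m, A i) := fun m =>
    mem_primePart_pi (fun i : Fin m => hA i) fun i : Fin m => hg.2 i
  have hT2 : T2Space G := hφ.isEmbedding.t2Space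
  have hTD : TotallyDisconnectedSpace G :=
    ⟨isTotallyDisconnected_of_image hφ.continuous.continuousOn hφ.injective
      (isTotallyDisconnected_of_totallyDisconnectedSpace _)⟩
  refine ⟨?_, inferInstance, inferInstance, fun N _ hN => ?_⟩
  · refine isCompact_iff_compactSpace.1 (?_ : IsCompact (_ : Set G))
    refine isCompact_of_finite_image_restrictFirst hφ
      (Subgroup.isClosed_topologicalClosure _) fun m => ?_
    have hfin : (Subgroup.zpowers (restrictFirst φ m g) : Set (∀ i : Fin m, A i)).Finite :=
      finite_zpowers.2 (hpart m).1
    exact hfin.subset (Set.image_subset_iff.2 (hle m))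
  · intro x
    obtain ⟨c, rfl⟩ := QuotientGroup.mk_surjective x
    have hN1 : (N : Set (Subgroup.zpowers g).topologicalClosure) ∈ 𝓝 1 := hN.mem_nhds N.one_mem
    rw [nhds_subtype_eq_comap] at hN1
    obtain ⟨V, hV, hVN⟩ := hN1
    obtain ⟨n, hn⟩ := exists_forall_mem_of_mem_nhds_one hφ.isInducing hV
    -- `N` contains all elements trivial in the first `n` coordinates, so it is enough that `c` has
    -- `p`-power order there.
    have hc : restrictFirst φ n c ∈ primePart {p} (∀ i : Fin n, A i) :=
      (Subgroup.zpowers_le.2 (hpart n)) (hle n c.2)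
    have hord : orderOf (restrictFirst φ n c) =
        p ^ (orderOf (restrictFirst φ n c)).primeFactorsList.length :=
      Nat.eq_prime_pow_of_unique_prime_dvd hc.1.orderOf_pos.ne' fun {q} hq hd => hc.2 q hq hd
    refine ⟨(orderOf (restrictFirst φ n c)).primeFactorsList.length, ?_⟩
    rw [← QuotientGroup.mk_pow, QuotientGroup.eq_one_iff]
    · refine hVN (hn _ fun i hi => ?_)
      have h1 := pow_orderOf_eq_one (restrictFirst φ n c)
      rw [hord] at h1
      have := congrFun h1 ⟨i, hi⟩
      simpa using this

lemma not_isLargeAt_singleton (hA : ∀ n, IsMulTorsion (A n)) {p : ℕ}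
    (h : LocallyCompactSpace (proPSylow p G)) : ¬ IsLargeAt φ {p} := by
  intro hL
  have hsub : ∀ n, (primaryTail φ n {p} : Set G) ⊆ proPSylow p G := fun n g hg =>
    isProPElement_of_mem_primaryTail hφ (primaryTail_anti (Nat.zero_le n) hg) hA
  obtain ⟨K, hK, hK1⟩ := exists_compact_mem_nhds (⟨1, hsub 0 (one_mem _)⟩ : proPSylow p G)
  rw [nhds_subtype_eq_comap] at hK1
  obtain ⟨V, hV, hVK⟩ := hK1
  obtain ⟨n, hn⟩ := exists_forall_mem_of_mem_nhds_one hφ.isInducing hV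
  obtain ⟨m, hm⟩ := hL n
  refine hm ((finite_image_restrictFirst_of_isCompact hφ.continuous
    (hK.image continuous_subtype_val) m).subset (Set.image_mono fun g hg => ?_))
  exact ⟨⟨g, hsub n hg⟩, hVK (hn g hg.1), rfl⟩

end proP

/-! ### Embedding the product into the quotient -/

section product

variable {G : Type*} [CommGroup G] {A : ℕ → Type*} [∀ n, CommGroup (A n)]

/-- The `k`-th component consists of the `Q k`-primary parts of the first `m k` coordinates. -/
noncomputable def primaryCoords (φ : G →* ∀ n, A n) (hA : ∀ n, IsMulTorsion (A n))
    (Q : ℕ → Set ℕ) (m : ℕ → ℕ) : G →* ∀ k, ∀ i : Fin (m k), A i where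
  toFun g k i := primeProj (Q k) (hA i) (φ g i)
  map_one' := by ext; simp
  map_mul' _ _ := by ext; simp

variable {φ : G →* ∀ n, A n} {hA : ∀ n, IsMulTorsion (A n)} {Q : ℕ → Set ℕ} {m : ℕ → ℕ}
  [TopologicalSpace G] [∀ n, TopologicalSpace (A n)]

lemma continuous_primaryCoords [∀ n, DiscreteTopology (A n)] (hφ : Continuous φ) :
    Continuous (primaryCoords φ hA Q m) :=
  continuous_pi fun k => continuous_pi fun i : Fin (m k) =>
    (continuous_of_discreteTopology (f := primeProj (Q k) (hA i))).comp ((continuous_apply (i : ℕ)).comp hφ)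

/-- The image of the `Q`-primary part of a tail in the first `m` coordinates. -/
abbrev tailImage (φ : G →* ∀ n, A n) (Q : ℕ → Set ℕ) (m : ℕ → ℕ) (k : ℕ) :
    Subgroup (∀ i : Fin (m k), A i) :=
  (primaryTail φ k (Q k)).map (restrictFirst φ (m k))

lemma exists_primaryCoords_eq (hφ : IsClosedEmbedding φ) (hQ : Pairwise (Function.onFun Disjoint Q))
    (x : ∀ k, tailImage φ Q m k) :
    ∃ g, (∀ k, primaryCoords φ hA Q m g k = x k) ∧
      ∀ n, (∀ k < n, x k = 1) → ∀ i < n, φ g i = 1 := by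
  -- Lifting 1 to 1 is what makes the section continuous at the identity.
  have hex : ∀ k, ∃ h ∈ primaryTail φ k (Q k), restrictFirst φ (m k) h = x k ∧
      (x k = 1 → h = 1) := fun k => by
    by_cases hk : x k = 1
    · exact ⟨1, one_mem _, by simp [hk], fun _ => rfl⟩
    · obtain ⟨h, hh, hx⟩ := (x k).2
      exact ⟨h, hh, hx, fun h' => absurd h' hk⟩
  choose h hmem hres hone using hex
  obtain ⟨g, hg⟩ := exists_map_eq_of_locally hφ
    -- This is the infinite product of the `h k`: factors with `k > i` are trivial at coordinate
    -- `i`.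
    (fun i => ∏ k ∈ Finset.range (i + 1), φ (h k) i) fun n => by
      refine ⟨∏ k ∈ Finset.range n, h k, fun i hi => ?_⟩
      rw [map_prod, Finset.prod_apply]
      refine (Finset.prod_subset (Finset.range_subset_range.2 hi) fun k _ hk => ?_).symm
      exact (hmem k).1 i (by simpa using hk)
  refine ⟨g, fun k => funext fun i => ?_, fun n hn i hi => ?_⟩
  · change primeProj (Q k) (hA i) (φ g i) = _
    rw [hg, map_prod, Finset.prod_eq_single k]
    · rw [primeProj_of_mem _ ((hmem k).2 i), ← hres k, restrictFirst_apply]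
    · exact fun j _ hj => primeProj_of_mem_of_disjoint _ (hQ hj.symm) ((hmem j).2 i)
    · intro hk
      rw [(hmem k).1 i (by simpa using hk), map_one]
  · rw [hg]
    refine Finset.prod_eq_one fun k hk => ?_
    rw [hone k (hn k ((Finset.mem_range_succ_iff.1 hk).trans_lt hi)), map_one, Pi.one_apply]

lemma exists_isClosedEmbedding_quotient_ker_primaryCoords [IsTopologicalGroup G]
    [∀ n, DiscreteTopology (A n)] (hφ : IsClosedEmbedding φ) (hQ : Pairwise (Function.onFun Disjoint Q)) :
    ∃ ψ : (∀ k, tailImage φ Q m k) →* G ⧸ (primaryCoords φ hA Q m).ker,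
      IsClosedEmbedding ψ := by
  set Θ := primaryCoords φ hA Q m
  have hinj : Function.Injective (QuotientGroup.kerLift Θ) := QuotientGroup.kerLift_injective Θ
  choose s hs hs1 using exists_primaryCoords_eq (hA := hA) (m := m) hφ hQ
  have hlift : ∀ x k, QuotientGroup.kerLift Θ (s x : G ⧸ Θ.ker) k = x k := hs
  let ψ : (∀ k, tailImage φ Q m k) →* G ⧸ Θ.ker :=
    { toFun := fun x => (s x : G ⧸ Θ.ker)
      map_one' := hinj (funext fun k => by rw [hlift, map_one]; rfl)
      map_mul' := fun x y => hinj (funext fun k => by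
        rw [hlift, map_mul]
        exact congrArg₂ (· * ·) (hlift x k).symm (hlift y k).symm) }
  have hcl : Continuous (QuotientGroup.kerLift Θ) :=
    (continuous_primaryCoords hφ.continuous).quotient_lift _
  have hincl : IsClosedEmbedding fun (x : ∀ k, tailImage φ Q m k) (k : ℕ) =>
      (x k : ∀ i : Fin (m k), A i) := by
    refine ⟨IsEmbedding.piMap fun k => IsEmbedding.subtypeVal, ?_⟩
    have : (Set.range fun (x : ∀ k, tailImage φ Q m k) (k : ℕ) =>
        (x k : ∀ i : Fin (m k), A i)) = Set.univ.pi fun k => (tailImage φ Q m k : Set _) := by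
      ext y
      refine ⟨?_, fun hy => ⟨fun k => ⟨y k, hy k trivial⟩, rfl⟩⟩
      rintro ⟨x, rfl⟩ k _
      exact (x k).2
    rw [this]
    exact isClosed_set_pi fun k _ => isClosed_discrete _
  have hcomp : QuotientGroup.kerLift Θ ∘ ψ = fun x k => (x k : ∀ i : Fin (m k), A i) :=
    funext fun x => funext fun k => hlift x k
  have hψ : Continuous ψ := by
    refine continuous_of_continuousAt_one ψ fun V hV => ?_
    rw [map_one] at hV
    have hV' : ((↑) : G → G ⧸ Θ.ker) ⁻¹' V ∈ 𝓝 (1 : G) :=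
      QuotientGroup.continuous_mk.continuousAt.preimage_mem_nhds hV
    obtain ⟨n, hn⟩ := exists_forall_mem_of_mem_nhds_one hφ.isInducing hV'
    have hW : (Set.Iio n).pi (fun k => ({1} : Set (tailImage φ Q m k))) ∈
        𝓝 (1 : ∀ k, tailImage φ Q m k) :=
      set_pi_mem_nhds (Set.finite_Iio n) fun k _ => (isOpen_discrete _).mem_nhds rfl
    exact Filter.mem_map.2 (Filter.mem_of_superset hW fun x hx => hn (s x) (hs1 x n hx))
  -- The closed inclusion factors through `ψ` by a continuous injection, so `ψ` is itself a closed
  -- embedding.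
  rw [← hcomp] at hincl
  refine ⟨ψ, IsEmbedding.of_comp hψ hcl hincl.isEmbedding, ?_⟩
  have : Set.range ψ = QuotientGroup.kerLift Θ ⁻¹' Set.range (QuotientGroup.kerLift Θ ∘ ψ) := by
    rw [Set.range_comp, Set.preimage_image_eq _ hinj]
  rw [this]
  exact hincl.isClosed_range.preimage hcl

end product

/-! ### Iteration and conclusion -/

lemma IsLargeAt.exists_pairwise_disjoint {G : Type*} [CommGroup G] [TopologicalSpace G]
    {A : ℕ → Type*} [∀ n, CommGroup (A n)] [∀ n, TopologicalSpace (A n)] {φ : G →* ∀ n, A n}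
    (hφ : IsClosedEmbedding φ) (hA : ∀ n, IsMulTorsion (A n)) {P : Set ℕ}
    (hP : IsLargeAt φ P) (hp : ∀ p : ℕ, p.Prime → ¬ IsLargeAt φ {p}) :
    ∃ (Q : ℕ → Set ℕ) (m : ℕ → ℕ), Pairwise (Function.onFun Disjoint Q) ∧
      ∀ k, (restrictFirst φ (m k) '' primaryTail φ k (Q k)).Infinite := by
  choose q hqP hq m hm using fun (R : {R : Set ℕ // IsLargeAt φ R}) (n : ℕ) =>
    R.2.exists_subset hφ hA hp n
  let R : ℕ → {R : Set ℕ // IsLargeAt φ R} := fun k =>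
    Nat.rec ⟨P, hP⟩ (fun n S => ⟨S.1 \ q S n, hq S n⟩) k
  have hR : ∀ k, (R (k + 1)).1 = (R k).1 \ q (R k) k := fun k => rfl
  have hanti : Antitone fun k => (R k).1 := antitone_nat_of_succ_le fun k => by
    rw [hR]; exact Set.sdiff_subset
  refine ⟨fun k => q (R k) k, fun k => m (R k) k, ?_, fun k => hm (R k) k⟩
  refine (pairwise_disjoint_on _).2 fun i j hij => ?_
  refine Set.disjoint_of_subset_right ((hqP (R j) j).trans (hanti (Nat.succ_le_of_lt hij))) ?_
  simp only [Nat.succ_eq_add_one, hR]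
  exact Set.disjoint_sdiff_right

theorem mainTheorem7 {G : Type*} [CommGroup G] [TopologicalSpace G] [IsTopologicalGroup G]
    [PolishSpace G] (hG : IsQuasiTorsion G) (hnlc : ¬ LocallyCompactSpace G)
    (hSylow : ∀ p : ℕ, p.Prime → LocallyCompactSpace (proPSylow p G)) :
    ∃ L : Subgroup G, IsClosed (L : Set G) ∧
      ∃ (K : ℕ → Type) (_ : ∀ n, Group (K n)) (_ : ∀ n, TopologicalSpace (K n)),
        (∀ n, Infinite (K n) ∧ Countable (K n) ∧ DiscreteTopology (K n)) ∧
        ∃ ψ : (∀ n, K n) →* G ⧸ L, IsClosedEmbedding ψ := by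
  obtain ⟨A, hgrp, htop, φ, hprop, hφ, hsurj⟩ := hG
  let _ : ∀ n, CommGroup (A n) := fun n =>
    { hgrp n with
      mul_comm := fun a b => by
        obtain ⟨g, rfl⟩ := hsurj n a
        obtain ⟨h, rfl⟩ := hsurj n b
        change (φ g * φ h) n = (φ h * φ g) n
        rw [← map_mul, mul_comm, map_mul] }
  have hcount : ∀ n, Countable (A n) := fun n => (hprop n).1
  have hdisc : ∀ n, DiscreteTopology (A n) := fun n => (hprop n).2.1
  have hA : ∀ n, IsMulTorsion (A n) := fun n => (hprop n).2.2
  have hlarge : IsLargeAt φ Set.univ := by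
    by_contra h
    exact hnlc (locallyCompactSpace_of_not_isLargeAt_univ hφ hA h)
  obtain ⟨Q, m, hQ, hinf⟩ := hlarge.exists_pairwise_disjoint hφ hA fun p hp =>
    not_isLargeAt_singleton hφ hA (hSylow p hp)
  refine ⟨(primaryCoords φ hA Q m).ker, ?_, fun k => tailImage φ Q m k, fun _ => inferInstance,
    fun _ => inferInstance, fun k => ⟨?_, inferInstance, inferInstance⟩,
    exists_isClosedEmbedding_quotient_ker_primaryCoords hφ hQ⟩
  · exact isClosed_singleton.preimage (continuous_primaryCoords (hA := hA) hφ.continuous)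
  · exact Set.infinite_coe_iff.2 (hinf k)
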